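/- Let $L/\mathbb{Q}$ be a finite Galois extension of degree $N=[L:\mathbb{Q}]$ whose class number $h(L)$ satisfies $h(L)>1$, and let $q$ be an odd prime divisor of $N$. Then there exists a subfield $F\subseteq L$ such that $L/F$ is a cyclic (Galois) extension of degree $[L:F]=q$. Moreover, let $F\subseteq L$ be any subfield such that $L/F$ is cyclic of degree $q$, let $m=[F:\mathbb{Q}]=N/q$, let $D_F$ be the discriminant of $F$, and put $$H_F=\frac{2^{m-1}}{(m-1)!}\,\sqrt{|D_F|}\,\bigl(\log|D_F|\bigr)^{m-1}$$ (with the convention $0^0=1$ when $m=1$). If $p$ is a prime with $p>H_F$ and $p\mid h(L)$, and $r_p$ is the $p$-rank of the class group of $L$, i.e. the number of factors in a decomposition of its $p$-primary part as a direct product of nontrivial cyclic groups, then $$p\,(p^{r_p}-1)\equiv 0 \pmod q .$$ -/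

import Mathlib

open NumberField

/-- For a number field `F` of degree `m` and discriminant `D`, the real number
`2 ^ (m - 1) / (m - 1)! * √|D| * (log |D|) ^ (m - 1)`. Here `m ≥ 1`, so that `m - 1` is the
honest difference. -/
noncomputable def geometricBound (F : Type*) [Field F] [NumberField F] : ℝ :=
  2 ^ (Module.finrank ℚ F - 1) / (Nat.factorial (Module.finrank ℚ F - 1) : ℝ) *
    Real.sqrt |(discr F : ℝ)| * Real.log |(discr F : ℝ)| ^ (Module.finrank ℚ F - 1)

/-- `HasPRank C p r`: the abelian group `C` has `p`-rank `r`, i.e. its `p`-primary part is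
isomorphic to a product of `r` nontrivial cyclic groups of `p`-power orders
`p ^ e 0, …, p ^ e (r - 1)`. -/
def HasPRank (C : Type*) [CommGroup C] (p : ℕ) [Fact p.Prime] (r : ℕ) : Prop :=
  ∃ e : Fin r → ℕ, (∀ i, 0 < e i) ∧
    Nonempty (CommGroup.primaryComponent C p ≃* ((i : Fin r) → Multiplicative (ZMod (p ^ e i))))

/-- Every finite abelian group has a `p`-rank. -/
theorem exists_hasPRank (C : Type*) [CommGroup C] [Finite C] (p : ℕ) [Fact p.Prime] :
    ∃ r, HasPRank C p r := by
  obtain ⟨ι, _, n, hn, ⟨f⟩⟩ :=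
    CommGroup.equiv_prod_multiplicative_zmod_of_finite (CommGroup.primaryComponent C p)
  have key : ∀ i, ∃ k, n i = p ^ k := by
    intro i
    obtain ⟨k, hk⟩ := (IsPGroup.iff_card (p := p)).1
      (CommGroup.primaryComponent.isPGroup (G := C) (p := p))
    have h1 : Nat.card (CommGroup.primaryComponent C p) = ∏ i, n i := by
      rw [Nat.card_congr f.toEquiv, Nat.card_pi]
      exact Finset.prod_congr rfl fun i _ => Nat.card_zmod (n i)
    have h2 : n i ∣ p ^ k := by
      rw [← hk, h1]
      exact Finset.dvd_prod_of_mem n (Finset.mem_univ i)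
    obtain ⟨j, -, hj⟩ := (Nat.dvd_prime_pow Fact.out).1 h2
    exact ⟨j, hj⟩
  choose k hk using key
  obtain rfl : n = fun i => p ^ k i := funext hk
  let g := (Fintype.equivFin ι).symm
  refine ⟨Fintype.card ι, fun i => k (g i), fun i => ?_, ⟨f.trans ?_⟩⟩
  · have := hn (g i)
    rcases Nat.eq_zero_or_pos (k (g i)) with h | h
    · simp [h] at this
    · exact h
  · exact
      { Equiv.piCongrLeft' (fun i => Multiplicative (ZMod (p ^ k i))) g.symm with
        map_mul' := fun _ _ => rfl }

/-!
Existence of `F` is Cauchy's theorem in `Gal(L/ℚ)` and Galois theory. For the congruence, put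
`G = Gal(L/F)`, a group of order `q`, and let `p ≠ q` (for `p = q` there is nothing to prove).

The hypothesis `p > H_F` is used only through `h(F) ≤ H_F` (`classNumber_le_geometricBound`), which
gives `p ∤ h(F)`. To see this bound, let `m = [F : ℚ]`. By Minkowski every ideal class contains an
ideal of norm at most `√|D_F|`. The number of ideals of norm at most `X` is at most the number of
`m`-tuples of positive integers with product at most `X` (`card_ideals_absNorm_le`): at most `m`
primes lie over each rational prime, so the primes can be given `m` colours such that distinct
primes of one colour lie over distinct rational primes, and then an ideal is determined by the norms
of the `m` parts of its factorization. The number of such tuples is at most `X (log X + m - 1) ^ (m - 1) / (m - 1)!`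
(`card_boundedProdTuples_le`), and `m - 1 ≤ (3 / 2) log |D_F|` by the Minkowski bound for the
discriminant.

For the congruence itself, `G` acts on the `p`-torsion of `Cl(L)`, a group of order `p ^ r`. The
product of the conjugates of an ideal `I` is the extension of its relative norm
(`map_relNorm_eq_prod_smul`), so if a class `C` is fixed by `G`, then `C ^ q` is the extension
of a class of `F`, whence `C ^ (q h(F)) = 1`. As `q h(F)` is prime to `p`, the only fixed point in
the `p`-torsion is the trivial class, and counting orbits of the `q`-group `G` gives
`p ^ r ≡ 1 (mod q)`.
-/

/-! ### Counting tuples of positive integers with bounded product -/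

theorem pow_succ_add_mul_le_add_pow_succ {a d : ℝ} (ha : 0 ≤ a) (hd : 0 ≤ d) (k : ℕ) :
    a ^ (k + 1) + (k + 1) * a ^ k * d ≤ (a + d) ^ (k + 1) := by
  induction k with
  | zero => simp
  | succ k ih =>
    have h1 : (a ^ (k + 1) + (k + 1) * a ^ k * d) * (a + d) ≤ (a + d) ^ (k + 1) * (a + d) :=
      mul_le_mul_of_nonneg_right ih (by positivity)
    have h2 : 0 ≤ (k + 1) * a ^ k * d * d := by positivity
    rw [pow_succ (a + d)]
    refine le_trans ?_ h1
    push_cast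
    rw [pow_succ a (k + 1), pow_succ a k] at *
    nlinarith

theorem one_div_le_log_succ_sub_log {n : ℕ} (hn : 1 ≤ n) :
    1 / ((n + 1 : ℕ) : ℝ) ≤ Real.log ((n + 1 : ℕ) : ℝ) - Real.log n := by
  have hn' : (0 : ℝ) < n := by exact_mod_cast hn
  have h := Real.log_le_sub_one_of_pos (x := (n : ℝ) / ((n + 1 : ℕ) : ℝ)) (by positivity)
  rw [Real.log_div hn'.ne' (by positivity)] at h
  have h2 : (n : ℝ) / ((n + 1 : ℕ) : ℝ) - 1 = - (1 / ((n + 1 : ℕ) : ℝ)) := by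
    push_cast
    field_simp
    ring
  linarith

/-- The discrete form of `∫ (c - log t) ^ k / t dt = - (c - log t) ^ (k + 1) / (k + 1)`. -/
theorem sum_sub_log_pow_div_le (c : ℝ) (k : ℕ) {N : ℕ} (hN : 1 ≤ N) (hc : Real.log N ≤ c) :
    ∑ n ∈ Finset.Icc 1 N, (c - Real.log n) ^ k / n ≤ (c + 1) ^ (k + 1) / (k + 1) := by
  have hk : (0 : ℝ) < k + 1 := by positivity
  have hc0 : 0 ≤ c := (Real.log_natCast_nonneg N).trans hc
  have key : ∑ n ∈ Finset.Icc 1 N, (c - Real.log n) ^ k / n ≤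
      c ^ k + (c ^ (k + 1) - (c - Real.log N) ^ (k + 1)) / (k + 1) := by
    induction N, hN using Nat.le_induction with
    | base => simp
    | succ n hn ih =>
      have hle : Real.log n ≤ Real.log ((n + 1 : ℕ) : ℝ) :=
        Real.log_le_log (by exact_mod_cast hn) (by push_cast; linarith)
      have h1 := ih (hle.trans hc)
      rw [Finset.sum_Icc_succ_top (by omega)]
      have hA : 0 ≤ c - Real.log ((n + 1 : ℕ) : ℝ) := sub_nonneg.2 hc
      have h2 := pow_succ_add_mul_le_add_pow_succ hA (sub_nonneg.2 hle) k
      rw [sub_add_sub_cancel] at h2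
      have h3 := mul_le_mul_of_nonneg_left (one_div_le_log_succ_sub_log hn)
        (show 0 ≤ ((k : ℝ) + 1) * (c - Real.log ((n + 1 : ℕ) : ℝ)) ^ k by positivity)
      have h4 : (c - Real.log ((n + 1 : ℕ) : ℝ)) ^ k / ((n + 1 : ℕ) : ℝ) ≤
          ((c - Real.log n) ^ (k + 1) - (c - Real.log ((n + 1 : ℕ) : ℝ)) ^ (k + 1)) / (k + 1) := by
        rw [le_div_iff₀ hk]
        calc _ = ((k : ℝ) + 1) * (c - Real.log ((n + 1 : ℕ) : ℝ)) ^ k *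
              (1 / ((n + 1 : ℕ) : ℝ)) := by ring
          _ ≤ _ := by linarith
      calc _ ≤ _ := add_le_add h1 h4
        _ = _ := by ring
  refine key.trans ?_
  have h5 := pow_succ_add_mul_le_add_pow_succ hc0 zero_le_one k
  have h6 : 0 ≤ (c - Real.log N) ^ (k + 1) := pow_nonneg (sub_nonneg.2 hc) _
  rw [le_div_iff₀ hk, add_mul, div_mul_cancel₀ _ hk.ne']
  linarith

/-- The `m`-tuples of positive integers whose product is at most `X`. -/
def boundedProdTuples (m X : ℕ) : Finset (Fin m → ℕ) :=
  (Fintype.piFinset fun _ => Finset.Icc 1 X).filter fun v => ∏ i, v i ≤ X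

theorem mem_boundedProdTuples {m X : ℕ} {v : Fin m → ℕ} :
    v ∈ boundedProdTuples m X ↔ (∀ i, 1 ≤ v i) ∧ ∏ i, v i ≤ X := by
  simp only [boundedProdTuples, Finset.mem_filter, Fintype.mem_piFinset, Finset.mem_Icc]
  refine ⟨fun h => ⟨fun i => (h.1 i).1, h.2⟩, fun h => ⟨fun i => ⟨h.1 i, ?_⟩, h.2⟩⟩
  exact (Finset.single_le_prod' (fun j _ => h.1 j) (Finset.mem_univ i)).trans h.2

theorem card_boundedProdTuples_succ_le (m X : ℕ) :
    (boundedProdTuples (m + 1) X).card ≤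
      ∑ n ∈ Finset.Icc 1 X, (boundedProdTuples m (X / n)).card := by
  classical
  have hmaps : ∀ v ∈ boundedProdTuples (m + 1) X, v 0 ∈ Finset.Icc 1 X := by
    intro v hv
    exact Finset.mem_Icc.2 ((Fintype.mem_piFinset.1 (Finset.mem_filter.1 hv).1 0) |>
      Finset.mem_Icc.1)
  rw [Finset.card_eq_sum_card_fiberwise hmaps]
  refine Finset.sum_le_sum fun n hn => ?_
  refine Finset.card_le_card_of_injOn Fin.tail ?_ ?_
  · intro v hv
    obtain ⟨hv', rfl⟩ := Finset.mem_filter.1 (Finset.mem_coe.1 hv)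
    rw [mem_boundedProdTuples, Fin.prod_univ_succ] at hv'
    refine mem_boundedProdTuples.2 ⟨fun i => hv'.1 i.succ, ?_⟩
    rw [Nat.le_div_iff_mul_le (hv'.1 0), mul_comm]
    exact hv'.2
  · intro v hv w hw h
    rw [← Fin.cons_self_tail v, ← Fin.cons_self_tail w, h, (Finset.mem_filter.1 hv).2,
      (Finset.mem_filter.1 hw).2]

/-- The classical bound `x (log x + k) ^ k / k!` for the summatory function of the `(k + 1)`-fold
divisor function. -/
theorem card_boundedProdTuples_le (k : ℕ) {X : ℕ} (hX : 1 ≤ X) :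
    ((boundedProdTuples (k + 1) X).card : ℝ) ≤ X * (Real.log X + k) ^ k / k.factorial := by
  induction k generalizing X with
  | zero =>
    have h := card_boundedProdTuples_succ_le 0 X
    have h' : ∀ n ∈ Finset.Icc 1 X, (boundedProdTuples 0 (X / n)).card ≤ 1 := fun n _ =>
      Finset.card_le_one_of_subsingleton _
    have := h.trans (Finset.sum_le_card_nsmul _ _ _ h')
    simpa using this
  | succ k ih =>
    have h1 : ((boundedProdTuples (k + 1 + 1) X).card : ℝ) ≤
        ∑ n ∈ Finset.Icc 1 X, ((boundedProdTuples (k + 1) (X / n)).card : ℝ) := by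
      exact_mod_cast card_boundedProdTuples_succ_le (k + 1) X
    have hX0 : (0 : ℝ) < X := by exact_mod_cast hX
    have h2 : ∀ n ∈ Finset.Icc 1 X, ((boundedProdTuples (k + 1) (X / n)).card : ℝ) ≤
        X / k.factorial * ((Real.log X + k - Real.log n) ^ k / n) := by
      intro n hn
      obtain ⟨hn1, hnX⟩ := Finset.mem_Icc.1 hn
      have hn0 : (0 : ℝ) < n := by exact_mod_cast hn1
      have hq : 1 ≤ X / n := (Nat.one_le_div_iff (by omega)).2 hnX
      have hq' : (0 : ℝ) < ((X / n : ℕ) : ℝ) := by exact_mod_cast hq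
      have hdiv : ((X / n : ℕ) : ℝ) ≤ X / n := Nat.cast_div_le
      have hlog : Real.log ((X / n : ℕ) : ℝ) ≤ Real.log X - Real.log n := by
        rw [← Real.log_div hX0.ne' hn0.ne']
        exact Real.log_le_log hq' hdiv
      have hlog0 := Real.log_natCast_nonneg (X / n)
      calc _ ≤ ((X / n : ℕ) : ℝ) * (Real.log ((X / n : ℕ) : ℝ) + k) ^ k / k.factorial := ih hq
        _ ≤ (X / n) * (Real.log X - Real.log n + k) ^ k / k.factorial := by gcongr
        _ = _ := by ring
    refine h1.trans ((Finset.sum_le_sum h2).trans ?_)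
    rw [← Finset.mul_sum]
    have h3 := sum_sub_log_pow_div_le (Real.log X + k) k hX (by simp)
    calc _ ≤ X / k.factorial * ((Real.log X + k + 1) ^ (k + 1) / (k + 1)) := by gcongr
      _ = _ := by
        rw [Nat.factorial_succ]
        push_cast
        field_simp
        ring

open Ideal UniqueFactorizationMonoid

/-! ### Counting ideals of bounded norm -/

/-- Since `∑ e f = [K : ℚ]`, at most `[K : ℚ]` primes of `𝓞 K` lie over a given rational prime. So
the primes of `𝓞 K` can be coloured with `[K : ℚ]` colours in such a way that primes of the same
colour lie over different rational primes. -/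
theorem exists_coloring_primes (K : Type*) [Field K] [NumberField K] :
    ∃ c : Ideal (𝓞 K) → Fin (Module.finrank ℚ K), ∀ P Q : Ideal (𝓞 K), P.IsPrime →
      Q.IsPrime → under ℤ P = under ℤ Q → c P = c Q → P = Q := by
  classical
  have : NeZero (Module.finrank ℚ K) := ⟨Module.finrank_pos.ne'⟩
  have key : ∀ p : Ideal ℤ, ∃ f : Ideal (𝓞 K) → Fin (Module.finrank ℚ K),
      p.IsPrime → Set.InjOn f (p.primesOver (𝓞 K)) := by
    intro p
    by_cases hp : p.IsPrime
    · have hfin : (p.primesOver (𝓞 K)).Finite := Algebra.QuasiFinite.finite_primesOver p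
      have : Fintype (p.primesOver (𝓞 K)) := hfin.fintype
      have hcard : Fintype.card (p.primesOver (𝓞 K)) ≤ Module.finrank ℚ K := by
        rw [← RingOfIntegers.rank K, ← sum_ramification_inertia_eq_finrank p (𝓞 K),
          ← Finset.card_univ, Finset.card_eq_sum_ones]
        refine Finset.sum_le_sum fun q _ => ?_
        have := q.2.1
        exact Nat.mul_pos (ramificationIdx_pos q.1 ℤ) (inertiaDeg_pos q.1 ℤ)
      obtain ⟨e⟩ := Function.Embedding.nonempty_of_card_le
        (α := p.primesOver (𝓞 K)) (β := Fin (Module.finrank ℚ K)) (by simpa using hcard)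
      refine ⟨fun P => if h : P ∈ p.primesOver (𝓞 K) then e ⟨P, h⟩ else 0, fun _ => ?_⟩
      intro P hP Q hQ h
      simp only [hP, hQ, dite_true] at h
      simpa using e.injective h
    · exact ⟨fun _ => 0, fun h => absurd h hp⟩
  choose f hf using key
  refine ⟨fun P => f (under ℤ P) P, fun P Q hP hQ h hc => ?_⟩
  exact hf (under ℤ P) (hP.under ℤ) ⟨hP, ⟨rfl⟩⟩ ⟨hQ, ⟨h⟩⟩ (by simpa only [h] using hc)

/-- The norm of the part of colour `i` of a product of ideals, given as the multiset of its
factors. -/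
noncomputable def colorNorm {R : Type*} [CommRing R] [IsDedekindDomain R] [Module.Free ℤ R]
    {ι : Type*} [DecidableEq ι] (c : Ideal R → ι) (s : Multiset (Ideal R)) (i : ι) : ℕ :=
  (s.map fun P => if c P = i then absNorm P else 1).prod

theorem prod_colorNorm {R : Type*} [CommRing R] [IsDedekindDomain R] [Module.Free ℤ R]
    {ι : Type*} [DecidableEq ι] [Fintype ι] (c : Ideal R → ι) (s : Multiset (Ideal R)) :
    ∏ i, colorNorm c s i = absNorm s.prod := by
  induction s using Multiset.induction_on with
  | empty => simp [colorNorm]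
  | cons P s ih =>
    simp only [colorNorm, Multiset.map_cons, Multiset.prod_cons, Finset.prod_mul_distrib,
      map_mul] at ih ⊢
    rw [ih]
    simp

/-- If distinct primes of the same colour have distinct residue characteristics, then the norms of
its coloured parts determine an ideal. -/
theorem eq_of_colorNorm_eq {K : Type*} [Field K] [NumberField K] {ι : Type*} [DecidableEq ι]
    {c : Ideal (𝓞 K) → ι}
    (hc : ∀ P Q : Ideal (𝓞 K), P.IsPrime → Q.IsPrime → under ℤ P = under ℤ Q →
      c P = c Q → P = Q)
    (s t : Multiset (Ideal (𝓞 K))) (hs : ∀ P ∈ s, P.IsPrime ∧ P ≠ ⊥)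
    (ht : ∀ P ∈ t, P.IsPrime ∧ P ≠ ⊥) (h : ∀ i, colorNorm c s i = colorNorm c t i) : s = t := by
  induction s using Multiset.induction_on generalizing t with
  | empty =>
    by_contra hne
    obtain ⟨P, hP⟩ := Multiset.exists_mem_of_ne_zero (Ne.symm hne)
    have h1 := Multiset.dvd_prod
      (Multiset.mem_map_of_mem (fun Q => if c Q = c P then absNorm Q else 1) hP)
    have h2 : colorNorm c t (c P) = 1 := by rw [← h]; simp [colorNorm]
    rw [colorNorm] at h2
    simp only [h2, if_true, Nat.dvd_one, absNorm_eq_one_iff] at h1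
    exact (ht P hP).1.ne_top h1
  | cons P s ih =>
    obtain ⟨hP, hP0⟩ := hs P (Multiset.mem_cons_self P s)
    have : NeZero P := ⟨hP0⟩
    have hp := Nat.absNorm_under_prime P
    have hdvd : absNorm (under ℤ P) ∣ colorNorm c t (c P) := by
      rw [← h, colorNorm, Multiset.map_cons, Multiset.prod_cons, if_pos rfl]
      exact (Int.absNorm_under_dvd_absNorm P).mul_right _
    obtain ⟨_, hn, hdvd⟩ := hp.prime.exists_mem_multiset_dvd hdvd
    obtain ⟨Q, hQ, rfl⟩ := Multiset.mem_map.1 hn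
    obtain ⟨hQp, hQ0⟩ := ht Q hQ
    have hcQ : c Q = c P := by
      by_contra hne
      rw [if_neg hne, Nat.dvd_one] at hdvd
      exact hp.one_lt.ne' hdvd
    rw [if_pos hcQ] at hdvd
    have hPQ : P = Q := by
      refine hc P Q hP hQp ?_ hcQ.symm
      obtain ⟨M, hM, hMu, hMQ⟩ := exists_isMaximal_dvd_of_dvd_absNorm' hp Q hdvd
      have hQmax : Q.IsMaximal := hQp.isMaximal hQ0
      rw [hQmax.eq_of_le hM.ne_top (le_of_dvd hMQ), hMu, Int.ideal_span_absNorm_eq_self]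
    subst hPQ
    obtain ⟨t, rfl⟩ := Multiset.exists_cons_of_mem hQ
    congr 1
    refine ih t (fun Q hQ => hs Q (Multiset.mem_cons_of_mem hQ))
      (fun Q hQ => ht Q (Multiset.mem_cons_of_mem hQ)) fun i => ?_
    have h1 := h i
    simp only [colorNorm, Multiset.map_cons, Multiset.prod_cons] at h1
    refine Nat.eq_of_mul_eq_mul_left ?_ h1
    split_ifs
    · exact Nat.pos_of_ne_zero fun h => hP0 (absNorm_eq_zero_iff.1 h)
    · exact one_pos

/-- The number of nonzero ideals of norm at most `X` is at most the number of `[K : ℚ]`-tuples of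
positive integers with product at most `X`; this is the
coefficientwise inequality `ζ_K ≤ ζ ^ [K : ℚ]`, summed up to `X`. -/
theorem card_ideals_absNorm_le {K : Type*} [Field K] [NumberField K] (X : ℕ)
    (A : Finset (Ideal (𝓞 K))) (hA : ∀ I ∈ A, I ≠ ⊥ ∧ absNorm I ≤ X) :
    A.card ≤ (boundedProdTuples (Module.finrank ℚ K) X).card := by
  classical
  obtain ⟨c, hc⟩ := exists_coloring_primes K
  have hprime : ∀ I : Ideal (𝓞 K), ∀ P ∈ normalizedFactors I, P.IsPrime ∧ P ≠ ⊥ := fun I P hP =>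
    ⟨isPrime_of_prime (prime_of_normalized_factor P hP), (prime_of_normalized_factor P hP).ne_zero⟩
  refine Finset.card_le_card_of_injOn (fun I => colorNorm c (normalizedFactors I)) ?_ ?_
  · intro I hI
    obtain ⟨hI0, hIX⟩ := hA I hI
    refine Finset.mem_coe.2 (mem_boundedProdTuples.2 ?_)
    have h := prod_colorNorm c (normalizedFactors I)
    rw [Ideal.prod_normalizedFactors_eq_self hI0] at h
    refine ⟨fun i => Nat.one_le_iff_ne_zero.2 fun h0 => hI0 ?_, h.trans_le hIX⟩
    rw [← absNorm_eq_zero_iff, ← h]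
    exact Finset.prod_eq_zero (Finset.mem_univ i) h0
  · intro I hI J hJ h
    rw [← Ideal.prod_normalizedFactors_eq_self (hA I hI).1,
      ← Ideal.prod_normalizedFactors_eq_self (hA J hJ).1,
      eq_of_colorNorm_eq hc _ _ (hprime I) (hprime J) (congrFun h)]

/-! ### The class number bound -/

theorem factorial_succ_mul_two_pow_le (k : ℕ) :
    ((k + 1).factorial : ℝ) * 2 ^ k ≤ ((k + 1 : ℕ) : ℝ) ^ (k + 1) := by
  induction k with
  | zero => simp
  | succ k ih =>
    have h := pow_succ_add_mul_le_add_pow_succ (a := ((k + 1 : ℕ) : ℝ)) (d := 1)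
      (by positivity) zero_le_one k
    rw [Nat.factorial_succ]
    push_cast at *
    have h2 : 2 * ((k : ℝ) + 1) ^ (k + 1) ≤ (k + 1 + 1) ^ (k + 1) := by
      refine le_trans (le_of_eq ?_) h
      ring
    calc ((k : ℝ) + 1 + 1) * ((k + 1).factorial) * 2 ^ (k + 1)
        = (k + 1 + 1) * (2 * ((k + 1).factorial * 2 ^ k)) := by ring
      _ ≤ (k + 1 + 1) * (2 * (k + 1) ^ (k + 1)) := by gcongr
      _ ≤ (k + 1 + 1) * (k + 1 + 1) ^ (k + 1) := by gcongr
      _ = _ := by ring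

/-- The factor in front of `√|D|` in the Minkowski bound is at most `1`. -/
theorem minkowski_factor_le_one {k s : ℕ} (hs : 2 * s ≤ k + 1) :
    (4 / Real.pi) ^ s * ((k + 1).factorial / ((k + 1 : ℕ) : ℝ) ^ (k + 1)) ≤ 1 := by
  have hpi : 4 / Real.pi ≤ 2 := by
    rw [div_le_iff₀ Real.pi_pos]
    linarith [Real.pi_gt_three]
  have h1 : (4 / Real.pi) ^ s ≤ 2 ^ k :=
    (pow_le_pow_left₀ (by positivity) hpi s).trans (pow_le_pow_right₀ one_le_two (by omega))
  rw [← mul_div_assoc, div_le_one (by positivity)]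
  calc _ ≤ (2 : ℝ) ^ k * (k + 1).factorial := by gcongr
    _ ≤ _ := by rw [mul_comm]; exact factorial_succ_mul_two_pow_le k

theorem finrank_sub_one_le_log_discr (F : Type*) [Field F] [NumberField F] {k : ℕ}
    (hk : Module.finrank ℚ F = k + 1) (hk1 : 1 ≤ k) :
    (k : ℝ) ≤ 3 / 2 * Real.log |(discr F : ℝ)| := by
  have h := abs_discr_ge (K := F) (by omega)
  rw [hk, Int.cast_abs] at h
  have h1 : (9 / 4 : ℝ) ^ k ≤ |(discr F : ℝ)| := by
    refine le_trans ?_ h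
    have hpi := Real.pi_gt_three
    have h2 : (9 / 4 : ℝ) ^ k ≤ (3 * Real.pi / 4) ^ k := by gcongr; linarith
    have h3 : (0 : ℝ) < (3 * Real.pi / 4) ^ k := by positivity
    rw [pow_succ]
    nlinarith
  have h2 := Real.log_le_log (by positivity) h1
  rw [Real.log_pow, show (9 / 4 : ℝ) = (3 / 2) ^ 2 by norm_num, Real.log_pow] at h2
  have h3 := Real.one_sub_inv_le_log_of_pos (show (0 : ℝ) < 3 / 2 by norm_num)
  push_cast at h2
  norm_num only at h3
  have h4 : (0 : ℝ) ≤ k := by positivity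
  nlinarith

/-- Choosing in each class an ideal of norm at most the Minkowski bound, which is at most `√|D|`,
embeds the class group into the set of ideals of norm at most `⌊√|D|⌋`. -/
theorem classNumber_le_card_boundedProdTuples (F : Type*) [Field F] [NumberField F] :
    ∃ X : ℕ, 1 ≤ X ∧ (X : ℝ) ≤ Real.sqrt |(discr F : ℝ)| ∧
      classNumber F ≤ (boundedProdTuples (Module.finrank ℚ F) X).card := by
  classical
  obtain ⟨k, hk⟩ : ∃ k, Module.finrank ℚ F = k + 1 :=
    Nat.exists_eq_succ_of_ne_zero Module.finrank_pos.ne'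
  have hM : ∀ C : ClassGroup (𝓞 F), ∃ I : (nonZeroDivisors (Ideal (𝓞 F))), ClassGroup.mk0 I = C ∧
      (absNorm (I : Ideal (𝓞 F)) : ℝ) ≤ Real.sqrt |(discr F : ℝ)| := by
    intro C
    obtain ⟨I, hI, hle⟩ := exists_ideal_in_class_of_norm_le C
    refine ⟨I, hI, hle.trans ?_⟩
    have hs := InfinitePlace.card_add_two_mul_card_eq_rank F
    rw [hk, ← mul_assoc]
    exact mul_le_of_le_one_left (Real.sqrt_nonneg _) (minkowski_factor_le_one (by omega))
  choose I hI hle using hM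
  refine ⟨⌊Real.sqrt |(discr F : ℝ)|⌋₊, ?_, Nat.floor_le (Real.sqrt_nonneg _), ?_⟩
  · refine Nat.le_floor (le_trans ?_ (hle 1))
    exact_mod_cast absNorm_pos_of_nonZeroDivisors (I 1)
  · have hinj : Function.Injective fun C => (I C : Ideal (𝓞 F)) := fun C D h => by
      rw [← hI C, ← hI D, Subtype.ext h]
    rw [classNumber, ← Finset.card_univ, ← Finset.card_image_of_injective _ hinj]
    refine card_ideals_absNorm_le _ _ fun J hJ => ?_
    obtain ⟨C, -, rfl⟩ := Finset.mem_image.1 hJ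
    exact ⟨nonZeroDivisors.coe_ne_zero _, Nat.le_floor (hle C)⟩

theorem classNumber_le_geometricBound (F : Type*) [Field F] [NumberField F] :
    (classNumber F : ℝ) ≤ geometricBound F := by
  obtain ⟨X, hX1, hX, hcard⟩ := classNumber_le_card_boundedProdTuples F
  obtain ⟨k, hk⟩ : ∃ k, Module.finrank ℚ F = k + 1 :=
    Nat.exists_eq_succ_of_ne_zero Module.finrank_pos.ne'
  rw [hk] at hcard
  have hX0 : (0 : ℝ) < X := by exact_mod_cast hX1
  have hlog0 := Real.log_natCast_nonneg X
  have hpow : (Real.log X + k) ^ k ≤ (2 * Real.log |(discr F : ℝ)|) ^ k := by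
    rcases Nat.eq_zero_or_pos k with rfl | hk1
    -- Here `F = ℚ` and `log |D| = 0`, but both sides are zeroth powers.
    · simp
    · refine pow_le_pow_left₀ (by positivity) ?_ k
      have h1 := finrank_sub_one_le_log_discr F hk hk1
      have h2 := Real.log_le_log hX0 hX
      rw [Real.log_sqrt (abs_nonneg _)] at h2
      linarith
  have hpow0 : 0 ≤ (2 * Real.log |(discr F : ℝ)|) ^ k := le_trans (by positivity) hpow
  calc (classNumber F : ℝ) ≤ (boundedProdTuples (k + 1) X).card := by exact_mod_cast hcard
    _ ≤ X * (Real.log X + k) ^ k / k.factorial := card_boundedProdTuples_le k hX1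
    _ ≤ Real.sqrt |(discr F : ℝ)| * (2 * Real.log |(discr F : ℝ)|) ^ k / k.factorial := by gcongr
    _ = geometricBound F := by
      rw [geometricBound, hk, Nat.add_sub_cancel]
      ring

/-! ### The Galois action on the class group -/

open scoped Pointwise nonZeroDivisors

section Action

variable {G R : Type*} [Group G] [CommRing R] [IsDedekindDomain R] [MulSemiringAction G R]

/-- The image of a nonzero ideal under a ring automorphism, as a nonzero ideal. -/
def smulNonZeroIdeal (g : G) (I : (Ideal R)⁰) : (Ideal R)⁰ :=
  ⟨g • (I : Ideal R), mem_nonZeroDivisors_iff_ne_zero.2 fun h =>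
    nonZeroDivisors.coe_ne_zero I ((smul_eq_zero_iff_eq g).1 h)⟩

theorem ClassGroup.mk0_smulNonZeroIdeal_congr (g : G) {I J : (Ideal R)⁰}
    (h : ClassGroup.mk0 I = ClassGroup.mk0 J) :
    ClassGroup.mk0 (smulNonZeroIdeal g I) = ClassGroup.mk0 (smulNonZeroIdeal g J) := by
  rw [ClassGroup.mk0_eq_mk0_iff] at h ⊢
  obtain ⟨x, y, hx, hy, h⟩ := h
  refine ⟨g • x, g • y, (smul_ne_zero_iff_ne g).2 hx, (smul_ne_zero_iff_ne g).2 hy, ?_⟩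
  have h' := congrArg (g • ·) h
  simpa only [smul_mul', Ideal.smul_closure, Set.smul_set_singleton, smulNonZeroIdeal] using h'

/-- The action of a ring automorphism on an ideal class, through a chosen representative. By
`ClassGroup.smul_mk0` it does not depend on the choice. -/
noncomputable instance ClassGroup.instSMulOfMulSemiringAction : SMul G (ClassGroup R) :=
  ⟨fun g C => ClassGroup.mk0 (smulNonZeroIdeal g (Function.surjInv ClassGroup.mk0_surjective C))⟩

theorem ClassGroup.smul_mk0 (g : G) (I : (Ideal R)⁰) :
    g • ClassGroup.mk0 I = ClassGroup.mk0 (smulNonZeroIdeal g I) :=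
  ClassGroup.mk0_smulNonZeroIdeal_congr g (Function.surjInv_eq ClassGroup.mk0_surjective _)

/-- A group acting on a Dedekind domain acts on its class group by `g • [I] = [g • I]`. -/
noncomputable instance ClassGroup.instMulDistribMulActionOfMulSemiringAction :
    MulDistribMulAction G (ClassGroup R) where
  one_smul C := by
    obtain ⟨I, rfl⟩ := ClassGroup.mk0_surjective C
    rw [ClassGroup.smul_mk0]
    congr 1
    exact Subtype.ext (one_smul G (I : Ideal R))
  mul_smul g h C := by
    obtain ⟨I, rfl⟩ := ClassGroup.mk0_surjective C
    simp only [ClassGroup.smul_mk0]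
    congr 1
    exact Subtype.ext (mul_smul g h (I : Ideal R))
  smul_mul g C D := by
    obtain ⟨I, rfl⟩ := ClassGroup.mk0_surjective C
    obtain ⟨J, rfl⟩ := ClassGroup.mk0_surjective D
    rw [← map_mul, ClassGroup.smul_mk0, ClassGroup.smul_mk0, ClassGroup.smul_mk0, ← map_mul]
    congr 1
    exact Subtype.ext (smul_mul' g (I : Ideal R) (J : Ideal R))
  smul_one g := by
    rw [← map_one ClassGroup.mk0, ClassGroup.smul_mk0]
    congr 1
    exact Subtype.ext (smul_one g)

end Action

section Norm

attribute [local instance] FractionRing.liftAlgebra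

variable {A B : Type*} [CommRing A] [IsDedekindDomain A] [CommRing B] [IsDedekindDomain B]
  [Algebra A B] [Module.Finite A B] [Module.IsTorsionFree A B]

theorem map_relNorm_le_prod_smul [IsGalois (FractionRing A) (FractionRing B)] (I : Ideal B) :
    (relNorm A I).map (algebraMap A B) ≤ ∏ σ : B ≃ₐ[A] B, σ • I := by
  rw [map_relNorm, span_le]
  rintro _ ⟨x, hx, rfl⟩
  rw [Function.comp_apply, SetLike.mem_coe, Algebra.algebraMap_intNorm_of_isGalois]
  exact prod_mem_prod (s := Finset.univ) fun (σ : B ≃ₐ[A] B) _ => smul_mem_pointwise_smul σ x I hx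

theorem absNorm_smul [Module.Free ℤ B] {G : Type*} [Group G] [MulSemiringAction G B] (g : G)
    (I : Ideal B) : absNorm (g • I) = absNorm I := by
  rw [absNorm_apply, absNorm_apply, Submodule.cardQuot_apply, Submodule.cardQuot_apply]
  exact (Nat.card_congr
    (quotientEquiv I (g • I) (MulSemiringAction.toRingEquiv G B g) rfl).toEquiv).symm

theorem eq_of_le_of_absNorm_eq [Module.Free ℤ B] [Module.Finite ℤ B] {I J : Ideal B} (hle : I ≤ J)
    (hI : I ≠ ⊥) (h : absNorm I = absNorm J) : I = J := by
  obtain ⟨M, rfl⟩ := dvd_iff_le.2 hle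
  have hJ : absNorm J ≠ 0 := fun h0 => hI (absNorm_eq_zero_iff.1 (h.trans h0))
  rw [map_mul, Nat.mul_eq_left hJ, absNorm_eq_one_iff] at h
  rw [h, mul_top]

theorem card_algEquiv_eq_finrank [IsGalois (FractionRing A) (FractionRing B)] :
    Nat.card (B ≃ₐ[A] B) = Module.finrank A B := by
  have : FiniteDimensional (FractionRing A) (FractionRing B) := .of_isLocalization A B A⁰
  rw [← Nat.card_congr (galRestrict A (FractionRing A) (FractionRing B) B).toEquiv,
    IsGalois.card_aut_eq_finrank,
    IsFractionRing.finrank_eq A (FractionRing A) B (FractionRing B)]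

variable [Module.Free ℤ A] [Module.Finite ℤ A] [CharZero A] [Module.Free ℤ B] [Module.Finite ℤ B]

/-- One inclusion holds because `N(x) = ∏ σ x`, and both sides have the same absolute norm. -/
theorem map_relNorm_eq_prod_smul [IsGalois (FractionRing A) (FractionRing B)] (I : Ideal B)
    (hI : I ≠ ⊥) :
    (relNorm A I).map (algebraMap A B) = ∏ σ : B ≃ₐ[A] B, σ • I := by
  refine eq_of_le_of_absNorm_eq (map_relNorm_le_prod_smul I) ?_ ?_
  · rw [Ne, Ideal.map_eq_bot_iff_of_injective (FaithfulSMul.algebraMap_injective A B)]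
    exact fun h => hI (relNorm_eq_bot_iff.1 h)
  · rw [absNorm_algebraMap, absNorm_relNorm, map_prod]
    simp only [absNorm_smul, Finset.prod_const, Finset.card_univ]
    rw [← card_algEquiv_eq_finrank, Nat.card_eq_fintype_card]

theorem prod_smul_eq_extendedHom [IsGalois (FractionRing A) (FractionRing B)] (C : ClassGroup B) :
    ∃ D : ClassGroup A, ∏ σ : B ≃ₐ[A] B, σ • C = ClassGroup.extendedHom A B D := by
  obtain ⟨I, rfl⟩ := ClassGroup.mk0_surjective C
  have hI := nonZeroDivisors.coe_ne_zero I
  refine ⟨ClassGroup.mk0 ⟨relNorm A (I : Ideal B), mem_nonZeroDivisors_iff_ne_zero.2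
    fun h => hI (relNorm_eq_bot_iff.1 h)⟩, ?_⟩
  simp only [ClassGroup.smul_mk0]
  rw [ClassGroup.extendedHom_mk0, ← map_prod]
  congr 1
  refine Subtype.ext ?_
  rw [Submonoid.coe_finsetProd]
  exact (map_relNorm_eq_prod_smul (I : Ideal B) hI).symm

/-- The `[B : A]`-th power of a class fixed by the Galois group is extended from `A`; so if the order
of the class is prime to both `[B : A]` and the class number of `A`, the class is trivial. -/
theorem eq_one_of_forall_smul_eq [IsGalois (FractionRing A) (FractionRing B)]
    {C : ClassGroup B} (hfix : ∀ σ : B ≃ₐ[A] B, σ • C = C) {n : ℕ} (hn : C ^ n = 1)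
    (h1 : n.Coprime (Nat.card (B ≃ₐ[A] B))) (h2 : n.Coprime (Nat.card (ClassGroup A))) : C = 1 := by
  obtain ⟨D, hD⟩ := prod_smul_eq_extendedHom (A := A) C
  simp only [hfix, Finset.prod_const, Finset.card_univ] at hD
  have h3 : C ^ (Nat.card (B ≃ₐ[A] B) * Nat.card (ClassGroup A)) = 1 := by
    rw [pow_mul, Nat.card_eq_fintype_card, hD, ← map_pow, pow_card_eq_one', map_one]
  rw [← orderOf_eq_one_iff, ← Nat.dvd_one, ← (h1.mul_right h2).gcd_eq_one]
  exact Nat.dvd_gcd (orderOf_dvd_of_pow_eq_one hn) (orderOf_dvd_of_pow_eq_one h3)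

/-- A `q`-group acting without nontrivial fixed points on the `p`-torsion of the class group forces
its order to be `1` modulo `q`. -/
theorem card_torsion_classGroup_modEq_one [IsGalois (FractionRing A) (FractionRing B)]
    [Finite (ClassGroup B)] {p q : ℕ} (hp : p.Prime) (hq : q.Prime) (hpq : p ≠ q)
    (hcard : Nat.card (B ≃ₐ[A] B) = q) (hA : ¬ p ∣ Nat.card (ClassGroup A)) :
    Nat.card {C : ClassGroup B // C ^ p = 1} ≡ 1 [MOD q] := by
  have : Fact q.Prime := ⟨hq⟩
  let act : MulAction (B ≃ₐ[A] B) {C : ClassGroup B // C ^ p = 1} :=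
    { smul := fun σ C => ⟨σ • C.1, by rw [← smul_pow', C.2, smul_one]⟩
      one_smul := fun C => Subtype.ext (one_smul _ C.1)
      mul_smul := fun σ τ C => Subtype.ext (mul_smul σ τ C.1) }
  have hG : IsPGroup q (B ≃ₐ[A] B) := IsPGroup.of_card (n := 1) (by rw [hcard, pow_one])
  refine (hG.card_modEq_card_fixedPoints {C : ClassGroup B // C ^ p = 1}).trans ?_
  have huniq : ∀ C ∈ MulAction.fixedPoints (B ≃ₐ[A] B) {C : ClassGroup B // C ^ p = 1},
      C = ⟨1, one_pow p⟩ := by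
    intro C hC
    refine Subtype.ext (eq_one_of_forall_smul_eq (A := A)
      (fun σ => congrArg Subtype.val (hC σ)) C.2 ?_ ((hp.coprime_iff_not_dvd).2 hA))
    rw [hcard]
    exact (Nat.coprime_primes hp hq).2 hpq
  have hset : MulAction.fixedPoints (B ≃ₐ[A] B) {C : ClassGroup B // C ^ p = 1} =
      {⟨1, one_pow p⟩} := by
    refine Set.eq_singleton_iff_unique_mem.2 ⟨fun σ => Subtype.ext (smul_one σ), huniq⟩
  rw [hset]
  simp only [Nat.card_unique]
  rfl

end Norm

/-! ### The `p`-torsion of a group of given `p`-rank -/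

theorem card_torsion_multiplicative_zmod {p e : ℕ} (hp : p.Prime) (he : 0 < e) :
    Nat.card {x : Multiplicative (ZMod (p ^ e)) // x ^ p = 1} = p := by
  have : NeZero (p ^ e) := ⟨(pow_pos hp.pos e).ne'⟩
  have : Finite (Multiplicative (ZMod (p ^ e))) := inferInstanceAs (Finite (ZMod (p ^ e)))
  have h := IsCyclic.card_powMonoidHom_ker (G := Multiplicative (ZMod (p ^ e))) p
  have h2 : Nat.card (Multiplicative (ZMod (p ^ e))) = p ^ e := Nat.card_zmod _
  rw [h2, Nat.gcd_eq_right (dvd_pow_self p he.ne')] at h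
  exact h

theorem HasPRank.card_torsion {C : Type*} [CommGroup C] {p : ℕ} [hp : Fact p.Prime] {r : ℕ}
    (h : HasPRank C p r) : Nat.card {x : C // x ^ p = 1} = p ^ r := by
  obtain ⟨e, he, ⟨f⟩⟩ := h
  -- The `p`-torsion of `C` lies in the `p`-primary component.
  let f₁ : {x : C // x ^ p = 1} ≃ {x : CommGroup.primaryComponent C p // x ^ p = 1} :=
    { toFun := fun x => ⟨⟨x.1, CommGroup.mem_primaryComponent.2 ⟨1, by rw [pow_one, x.2]⟩⟩,
        Subtype.ext x.2⟩
      invFun := fun x => ⟨x.1.1, congrArg Subtype.val x.2⟩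
      left_inv := fun _ => rfl
      right_inv := fun _ => rfl }
  let f₂ : {x : CommGroup.primaryComponent C p // x ^ p = 1} ≃
      {x : (i : Fin r) → Multiplicative (ZMod (p ^ e i)) // ∀ i, x i ^ p = 1} :=
    f.toEquiv.subtypeEquiv fun x => by
      rw [← map_eq_one_iff f f.injective, map_pow, funext_iff]
      rfl
  rw [Nat.card_congr (f₁.trans (f₂.trans (Equiv.subtypePiEquivPi
    (p := fun i (y : Multiplicative (ZMod (p ^ e i))) => y ^ p = 1)))), Nat.card_pi]
  rw [Finset.prod_congr rfl fun i _ => card_torsion_multiplicative_zmod hp.out (he i)]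
  simp

/-! ### Cyclic subextensions of prime degree -/

/-- Take the fixed field of a subgroup of order `q`. -/
theorem exists_cyclic_subextension_of_prime_dvd {K L : Type*} [Field K] [Field L] [Algebra K L]
    [FiniteDimensional K L] [IsGalois K L] {q : ℕ} (hq : q.Prime) (hdvd : q ∣ Module.finrank K L) :
    ∃ F : IntermediateField K L,
      IsGalois F L ∧ IsCyclic (L ≃ₐ[F] L) ∧ Module.finrank F L = q := by
  have : Fact q.Prime := ⟨hq⟩
  rw [← IsGalois.card_aut_eq_finrank] at hdvd
  obtain ⟨σ, hσ⟩ := exists_prime_orderOf_dvd_card' q hdvd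
  have hcard : Nat.card (Subgroup.zpowers σ) = q := by rw [Nat.card_zpowers, hσ]
  refine ⟨IntermediateField.fixedField (Subgroup.zpowers σ), inferInstance, ?_, ?_⟩
  · exact isCyclic_of_surjective (IntermediateField.subgroupEquivAlgEquiv (Subgroup.zpowers σ))
      (MulEquiv.surjective _)
  · rw [IntermediateField.finrank_fixedField_eq_card, hcard]

attribute [local instance] FractionRing.liftAlgebra in
/-- For a Galois extension `L / K` of prime degree `q` and a prime `p ≠ q` not dividing the class
number of `K`, the order of the `p`-torsion of the class group of `L` is `1` modulo `q`. -/
theorem card_torsion_classGroup_ringOfIntegers_modEq_one {K L : Type*} [Field K] [NumberField K]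
    [Field L] [NumberField L] [Algebra K L] [IsGalois K L] {p q : ℕ} (hp : p.Prime) (hq : q.Prime)
    (hpq : p ≠ q) (hfin : Module.finrank K L = q) (hK : ¬ p ∣ classNumber K) :
    Nat.card {C : ClassGroup (𝓞 L) // C ^ p = 1} ≡ 1 [MOD q] := by
  have : IsGalois (FractionRing (𝓞 K)) (FractionRing (𝓞 L)) := by
    refine IsGalois.of_equiv_equiv (f := (FractionRing.algEquiv (𝓞 K) K).toRingEquiv.symm)
      (g := (FractionRing.algEquiv (𝓞 L) L).toRingEquiv.symm) <|
        RingHom.ext fun x ↦ IsFractionRing.algEquiv_commutes (FractionRing.algEquiv (𝓞 K) K).symm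
          (FractionRing.algEquiv (𝓞 L) L).symm _
  have : Module.Finite (𝓞 K) (𝓞 L) := IsIntegralClosure.finite (𝓞 K) K L (𝓞 L)
  refine card_torsion_classGroup_modEq_one (A := 𝓞 K) hp hq hpq ?_ ?_
  · rw [card_algEquiv_eq_finrank, ← IsFractionRing.finrank_eq (𝓞 K) K (𝓞 L) L, hfin]
  · rwa [Nat.card_eq_fintype_card]

theorem corollaryc212151 (L : Type*) [Field L] [NumberField L] [IsGalois ℚ L]
    (hL : 1 < NumberField.classNumber L)
    (q : ℕ) (hq : q.Prime) (hq_odd : Odd q) (hqN : q ∣ Module.finrank ℚ L) :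
    (∃ F : IntermediateField ℚ L,
      IsGalois F L ∧ IsCyclic (L ≃ₐ[F] L) ∧ Module.finrank F L = q) ∧
    ∀ F : IntermediateField ℚ L,
      IsGalois F L → IsCyclic (L ≃ₐ[F] L) → Module.finrank F L = q →
      ∀ (p : ℕ) [Fact p.Prime], geometricBound F < (p : ℝ) → p ∣ NumberField.classNumber L →
      ∀ r : ℕ, HasPRank (ClassGroup (NumberField.RingOfIntegers L)) p r →
        (p : ℤ) * ((p : ℤ) ^ r - 1) ≡ 0 [ZMOD (q : ℤ)] := by
  refine ⟨exists_cyclic_subextension_of_prime_dvd hq hqN, ?_⟩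
  intro F _ _ hfin p hp hlt _ r hr
  rw [Int.modEq_zero_iff_dvd]
  rcases eq_or_ne p q with rfl | hpq
  · exact dvd_mul_right _ _
  · refine Dvd.dvd.mul_left ?_ _
    have hF : ¬ p ∣ classNumber F := fun hdvd => by
      have h1 : (p : ℝ) ≤ classNumber F := by
        exact_mod_cast Nat.le_of_dvd (classNumber_pos F) hdvd
      exact absurd (h1.trans (classNumber_le_geometricBound F)) (not_le.2 hlt)
    have h := card_torsion_classGroup_ringOfIntegers_modEq_one hp.out hq hpq hfin hF
    rw [hr.card_torsion] at h
    have h' := (Nat.modEq_iff_dvd.1 h.symm)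
    exact_mod_cast h'
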